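/- Let $N=2n+1$ be odd, let $V\cong\mathbb{C}^N$ be a complex vector space with a non-degenerate symmetric bilinear form $(-,-)$, fix $m<N/2$, and let $\mathrm{OG}=\mathrm{OG}(m,N)$ be the orthogonal Grassmannian of $m$-dimensional isotropic subspaces of $V$, with its Zariski topology. Fix an isotropic flag $0=F_0\subsetneq F_1\subsetneq\dots\subsetneq F_N=V$ (that is, $F_i=F_j^\perp$ whenever $i+j=N$), let $B\subset\mathrm{SO}(V)$ be the Borel subgroup stabilizing it, and fix a basis $e_1,\dots,e_N$ of $V$ with $(e_i,e_j)=\delta_{i+j,N+1}$ and $F_p=\langle e_1,\dots,e_p\rangle$ for each $p$. An \emph{index set} is a subset $P=\{p_1<\dots<p_m\}\subset[1,N]$ of cardinality $m$ such that $i+j\neq N+1$ for all $i,j\in P$ (including $i=j$). For an index set $P$ let $X_P^\circ=B\cdot\langle e_p : p\in P\rangle\subset\mathrm{OG}$, and let the Schubert variety $X_P=\overline{X_P^\circ}$ be its Zariski closure in $\mathrm{OG}$. For index sets $P=\{p_1<\dots<p_m\}$ and $Q=\{q_1<\dots<q_m\}$ write $Q\leq P$ if $q_j\leq p_j$ for each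 $j$. Then for any index set $P=\{p_1<\dots<p_m\}$ we have \[ X_P=Y_P:=\{\Sigma\in\mathrm{OG}\mid \dim(\Sigma\cap F_{p_j})\geq j\ \text{ for all } 1\leq j\leq m\}. \] Moreover, for any two index sets $P$ and $Q$, we have $X_Q\subset X_P$ if and only if $Q\leq P$. -/

import Mathlib

open Module

namespace OrthogonalGrassmannian

variable {V : Type*} [AddCommGroup V] [Module ℂ V]

/-- The orthogonal Grassmannian `OG(m, V)` of `m`-dimensional isotropic subspaces of `V`. -/
def OG (B : LinearMap.BilinForm ℂ V) (m : ℕ) : Type _ :=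
  {S : Submodule ℂ V // finrank ℂ S = m ∧ ∀ x ∈ S, ∀ y ∈ S, B x y = 0}

/-- The Plücker coordinates of an `m`-tuple of vectors `v`. The coordinate labelled by the linear
forms `φ₁, …, φₘ` is the value of `φ₁ ∧ ⋯ ∧ φₘ` on `v₁ ∧ ⋯ ∧ vₘ`, i.e. `det (φ_a (v_b))`. -/
noncomputable def pluecker {m : ℕ} (v : Fin m → V) (φ : Fin m → Dual ℂ V) : ℂ :=
  Matrix.det (Matrix.of fun a b => φ a (v b))

/-- The locus in `OG(m, V)` where a polynomial `f` in the Plücker coordinates does not vanish.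
For homogeneous `f` the condition does not depend on the basis `v` of the subspace. -/
def nonvanishing (B : LinearMap.BilinForm ℂ V) (m : ℕ)
    (f : MvPolynomial (Fin m → Dual ℂ V) ℂ) : Set (OG B m) :=
  {S | ∃ v : Basis (Fin m) ℂ S.1, MvPolynomial.eval (pluecker fun b => (v b : V)) f ≠ 0}

/-- The Zariski topology on `OG(m, V)`, as a subvariety of the projective space of `⋀ᵐ V` by the
Plücker embedding: it is generated by the nonvanishing loci of homogeneous polynomials. -/
instance zariskiTopology (B : LinearMap.BilinForm ℂ V) (m : ℕ) : TopologicalSpace (OG B m) :=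
  TopologicalSpace.generateFrom
    {U | ∃ (d : ℕ) (f : MvPolynomial (Fin m → Dual ℂ V) ℂ),
      f.IsHomogeneous d ∧ U = nonvanishing B m f}

/-- An isotropic flag `0 = F₀ ⊊ F₁ ⊊ ⋯ ⊊ F_N = V`, with `F_i = F_j^⊥` whenever `i + j = N`. -/
structure IsIsotropicFlag (B : LinearMap.BilinForm ℂ V) {N : ℕ}
    (F : Fin (N + 1) → Submodule ℂ V) : Prop where
  zero : F 0 = ⊥
  last : F (Fin.last N) = ⊤
  strictMono : StrictMono F
  orthogonal : ∀ i j : Fin (N + 1), (i : ℕ) + j = N → F i = B.orthogonal (F j)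

/-- A basis `e₁, …, e_N` with `(e_i, e_j) = δ_{i+j, N+1}` and `F_p = ⟨e₁, …, e_p⟩` for each `p`.
The vector `e_i` is `e ⟨i - 1, _⟩` here. -/
structure IsAdaptedBasis (B : LinearMap.BilinForm ℂ V) {N : ℕ}
    (F : Fin (N + 1) → Submodule ℂ V) (e : Basis (Fin N) ℂ V) : Prop where
  form : ∀ i j : Fin N, B (e i) (e j) = if ((i : ℕ) + 1) + ((j : ℕ) + 1) = N + 1 then 1 else 0
  flag : ∀ p : Fin (N + 1), F p = Submodule.span ℂ (e '' {i | (i : ℕ) + 1 ≤ p})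

/-- `SO(V)`: the linear automorphisms of determinant one that preserve the form. -/
def specialOrthogonal (B : LinearMap.BilinForm ℂ V) : Subgroup (V ≃ₗ[ℂ] V) where
  carrier := {g | (∀ x y, B (g x) (g y) = B x y) ∧ LinearEquiv.det g = 1}
  one_mem' := ⟨fun _ _ => rfl, map_one _⟩
  mul_mem' := by
    rintro g h ⟨hg, hg'⟩ ⟨hh, hh'⟩
    refine ⟨fun x y => ?_, by rw [map_mul, hg', hh', one_mul]⟩
    rw [LinearEquiv.mul_apply, LinearEquiv.mul_apply, hg, hh]
  inv_mem' := by
    rintro g ⟨hg, hg'⟩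
    refine ⟨fun x y => ?_, by rw [map_inv, hg', inv_one]⟩
    rw [← hg, ← LinearEquiv.mul_apply, ← LinearEquiv.mul_apply, mul_inv_cancel]
    rfl

/-- The elements of the Borel subgroup of `SO(V)` stabilizing the flag `F`. -/
def borel (B : LinearMap.BilinForm ℂ V) {N : ℕ} (F : Fin (N + 1) → Submodule ℂ V) :
    Set (V ≃ₗ[ℂ] V) :=
  {g | g ∈ specialOrthogonal B ∧ ∀ i, (F i).map (g : V →ₗ[ℂ] V) = F i}

/-- Index sets: `m`-element subsets `P` of `{1, …, N}` with `i + j ≠ N + 1` for all `i, j ∈ P`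
(including `i = j`). The integer `i` is represented by `⟨i - 1, _⟩ : Fin N`. -/
structure IndexSet (N m : ℕ) where
  carrier : Finset (Fin N)
  card_eq : carrier.card = m
  add_ne : ∀ i ∈ carrier, ∀ j ∈ carrier, ((i : ℕ) + 1) + ((j : ℕ) + 1) ≠ N + 1

namespace IndexSet

variable {N m : ℕ}

/-- The increasing enumeration `p₁ < ⋯ < pₘ` of an index set; `p_{j+1}` is `P.elem j`, with its
representation in `Fin N` shifted by one as above. -/
def elem (P : IndexSet N m) : Fin m ↪o Fin N := P.carrier.orderEmbOfFin P.card_eq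

/-- `Q ≤ P` if `q_j ≤ p_j` for each `j`. -/
instance : LE (IndexSet N m) := ⟨fun Q P => ∀ j, Q.elem j ≤ P.elem j⟩

end IndexSet

/-- The Schubert cell: the orbit of `⟨e_p : p ∈ P⟩` under the Borel subgroup stabilizing `F`. -/
def schubertCell (B : LinearMap.BilinForm ℂ V) {N m : ℕ} (F : Fin (N + 1) → Submodule ℂ V)
    (e : Basis (Fin N) ℂ V) (P : IndexSet N m) : Set (OG B m) :=
  {S | ∃ g ∈ borel B F, S.1 = (Submodule.span ℂ (e '' P.carrier)).map (g : V →ₗ[ℂ] V)}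

/-- The Schubert variety `X_P`: the Zariski closure of the Schubert cell. -/
def schubertVariety (B : LinearMap.BilinForm ℂ V) {N m : ℕ} (F : Fin (N + 1) → Submodule ℂ V)
    (e : Basis (Fin N) ℂ V) (P : IndexSet N m) : Set (OG B m) :=
  closure (schubertCell B F e P)

/-- `Y_P = {Σ | dim (Σ ∩ F_{p_j}) ≥ j for 1 ≤ j ≤ m}`. Both the index `j` and the number `p_j` are
shifted by one, so `F_{p_j}` is `F (P.elem j).succ`. -/
def rankLocus (B : LinearMap.BilinForm ℂ V) {N m : ℕ} (F : Fin (N + 1) → Submodule ℂ V)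
    (P : IndexSet N m) : Set (OG B m) :=
  {S | ∀ j : Fin m, (j : ℕ) + 1 ≤ finrank ℂ (S.1 ⊓ F (P.elem j).succ : Submodule ℂ V)}

end OrthogonalGrassmannian

/-! Reduce a subspace to echelon form along the flag: its leading positions (`leads`) determine
every dimension `dim (S ∩ F_k)` by counting, and for isotropic `S` they form an index set. Eichler
transformations move the vectors `e_q` one at a time into `S`, so `S` lies in the cell of its
leading positions (`mem_schubertCell`). Thus the cells partition the Grassmannian, and `Y_P` is the
union of the cells of all `Q ≤ P` (`mem_rankLocus_iff`). `Y_P` is closed: around a point of a cell,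
the nonvanishing of one Plücker coordinate bounds all these dimensions from above
(`exists_isOpen_finrank_le`). Hence `X_P ⊆ Y_P`. For the converse, if `Q ≤ P` and `Q ≠ P`, some
elementary step lowers `P` while staying above `Q` (`exists_isStep`). Each step is the limit of an
explicit curve of isotropic subspaces (`schubertCell_subset_of_single`,
`schubertCell_subset_of_double`). Induction on the sum of the elements of `P` puts the cell of `Q`
inside `X_P`. The inclusion criterion then follows, since all points of a cell have the same leading
positions. -/

namespace OrthogonalGrassmannian

/-! ### Leading positions of subspaces with respect to the flag. -/

section

variable {V : Type*} [AddCommGroup V] [Module ℂ V] {N : ℕ}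

/-- The subspace spanned by the first `k` vectors of a basis, in terms of coordinates. -/
def initial (e : Basis (Fin N) ℂ V) (k : ℕ) : Submodule ℂ V where
  carrier := {x | ∀ i : Fin N, k ≤ i → e.repr x i = 0}
  add_mem' := fun ha hb i hi => by simp [ha i hi, hb i hi]
  zero_mem' := fun i _ => by simp
  smul_mem' := fun c x hx i hi => by simp [hx i hi]

lemma mem_initial {e : Basis (Fin N) ℂ V} {k : ℕ} {x : V} :
    x ∈ initial e k ↔ ∀ i : Fin N, k ≤ i → e.repr x i = 0 := Iff.rfl

lemma initial_mono (e : Basis (Fin N) ℂ V) {k l : ℕ} (h : k ≤ l) : initial e k ≤ initial e l :=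
  fun _ hx i hi => hx i (h.trans hi)

lemma basis_mem_initial (e : Basis (Fin N) ℂ V) {i : Fin N} {k : ℕ} (h : (i : ℕ) < k) :
    e i ∈ initial e k := by
  intro l hl
  rw [e.repr_self, Finsupp.single_eq_of_ne]
  rintro rfl
  omega

lemma IsAdaptedBasis.flag_eq {B : LinearMap.BilinForm ℂ V} {F : Fin (N + 1) → Submodule ℂ V}
    {e : Basis (Fin N) ℂ V} (he : IsAdaptedBasis B F e) (p : Fin (N + 1)) :
    F p = initial e p := by
  ext x
  rw [he.flag, Basis.mem_span_image, mem_initial]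
  constructor
  · intro h i hi
    by_contra h0
    have := h (Finsupp.mem_support_iff.2 h0)
    simp only [Set.mem_ofPred_eq] at this
    omega
  · intro h i hi
    by_contra h0
    simp only [Set.mem_ofPred_eq] at h0
    exact (Finsupp.mem_support_iff.1 hi) (h i (by omega))

/-- The elements of `A` smaller than `k`. -/
def below (A : Finset (Fin N)) (k : ℕ) : Finset (Fin N) := A.filter fun i : Fin N => (i : ℕ) < k

lemma mem_below {A : Finset (Fin N)} {k : ℕ} {i : Fin N} :
    i ∈ below A k ↔ i ∈ A ∧ (i : ℕ) < k := Finset.mem_filter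

open Classical in
/-- The positions of the leading coefficients of the vectors of a subspace. -/
noncomputable def leads (e : Basis (Fin N) ℂ V) (S : Submodule ℂ V) : Finset (Fin N) :=
  {i | ∃ u ∈ S, u ∈ initial e (i + 1) ∧ e.repr u i ≠ 0}

lemma mem_leads {e : Basis (Fin N) ℂ V} {S : Submodule ℂ V} {i : Fin N} :
    i ∈ leads e S ↔ ∃ u ∈ S, u ∈ initial e (i + 1) ∧ e.repr u i ≠ 0 := by
  simp [leads]

lemma initial_succ_inf_ker (e : Basis (Fin N) ℂ V) (i : Fin N) {x : V} :
    x ∈ initial e i ↔ x ∈ initial e (i + 1) ∧ e.repr x i = 0 := by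
  constructor
  · exact fun h => ⟨initial_mono e (Nat.le_succ _) h, h i le_rfl⟩
  · rintro ⟨h, h0⟩ k hk
    rcases hk.eq_or_lt with h1 | h1
    · rwa [← Fin.ext h1]
    · exact h k h1

lemma initial_zero (e : Basis (Fin N) ℂ V) : initial e 0 = ⊥ := by
  rw [eq_bot_iff]
  intro x hx
  rw [Submodule.mem_bot, ← e.repr.map_eq_zero_iff]
  ext i
  exact hx i (Nat.zero_le _)

lemma initial_of_le (e : Basis (Fin N) ℂ V) {k : ℕ} (h : N ≤ k) : initial e k = ⊤ := by
  rw [eq_top_iff]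
  intro x _ i hi
  omega

/-- The dimensions of the intersections with the standard flag are given by the leading positions. -/
lemma finrank_inf_initial (e : Basis (Fin N) ℂ V) (S : Submodule ℂ V) (k : ℕ) :
    finrank ℂ (S ⊓ initial e k : Submodule ℂ V) = (below (leads e S) k).card := by
  have : FiniteDimensional ℂ V := e.finiteDimensional_of_finite
  induction k with
  | zero => simp [initial_zero, below]
  | succ k ih =>
    by_cases hk : N ≤ k
    · rw [initial_of_le e (hk.trans k.le_succ), ← initial_of_le e hk, ih]
      congr 1
      ext i
      simp only [mem_below]
      have := i.2
      constructor <;> rintro ⟨h, _⟩ <;> exact ⟨h, by omega⟩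
    · push Not at hk
      let i : Fin N := ⟨k, hk⟩
      let T : Submodule ℂ V := S ⊓ initial e (k + 1)
      -- The kernel of `φ` is `S ⊓ initial e k`; its rank is 1 or 0 according to whether `k` is a
      -- leading position, so rank-nullity gives the inductive step.
      let φ : T →ₗ[ℂ] ℂ := (e.coord i).comp T.subtype
      have hrn := φ.finrank_range_add_finrank_ker
      have hker : finrank ℂ (LinearMap.ker φ) = finrank ℂ (S ⊓ initial e k : Submodule ℂ V) := by
        have hmap : (LinearMap.ker φ).map T.subtype = S ⊓ initial e k := by
          ext x
          simp only [Submodule.mem_map, LinearMap.mem_ker, Submodule.subtype_apply, Subtype.exists,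
            Submodule.mem_inf]
          have := initial_succ_inf_ker e i (x := x)
          constructor
          · rintro ⟨y, ⟨hy1, hy2⟩, h0, rfl⟩
            exact ⟨hy1, this.2 ⟨hy2, h0⟩⟩
          · rintro ⟨h1, h2⟩
            exact ⟨x, ⟨h1, (this.1 h2).1⟩, (this.1 h2).2, rfl⟩
        rw [← hmap]
        exact (LinearEquiv.finrank_eq (Submodule.equivMapOfInjective _ T.injective_subtype _))
      have hset : below (leads e S) (k + 1) =
          if i ∈ leads e S then insert i (below (leads e S) k)
          else below (leads e S) k := by
        ext j
        have hj : j = i ↔ (j : ℕ) = k := Fin.ext_iff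
        split_ifs with h
        · simp only [mem_below, Finset.mem_insert, hj]
          constructor
          · rintro ⟨h1, h2⟩
            by_cases h3 : (j : ℕ) = k
            · exact Or.inl h3
            · exact Or.inr ⟨h1, by omega⟩
          · rintro (h1 | ⟨h1, h2⟩)
            · exact ⟨(hj.2 h1) ▸ h, by omega⟩
            · exact ⟨h1, by omega⟩
        · simp only [mem_below]
          constructor
          · rintro ⟨h1, h2⟩
            refine ⟨h1, lt_of_le_of_ne (by omega) fun h3 => h ((hj.2 h3) ▸ h1)⟩
          · rintro ⟨h1, h2⟩
            exact ⟨h1, by omega⟩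
      rw [hset]
      split_ifs with h
      · rw [Finset.card_insert_of_notMem (by simp [i, mem_below])]
        obtain ⟨u, hu1, hu2, hu3⟩ := mem_leads.1 h
        have hr : LinearMap.range φ = ⊤ := by
          rw [LinearMap.range_eq_top]
          apply LinearMap.surjective_of_ne_zero
          intro h0
          exact hu3 (LinearMap.congr_fun h0 ⟨u, hu1, hu2⟩)
        rw [hr, finrank_top, finrank_self, hker, ih] at hrn
        rw [← hrn, add_comm]
      · have hr : φ = 0 := by
          ext ⟨u, hu1, hu2⟩
          by_contra h0
          exact h (mem_leads.2 ⟨u, hu1, hu2, h0⟩)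
        rw [hr, LinearMap.range_zero, finrank_bot, zero_add, ← hr, hker, ih] at hrn
        exact hrn.symm

lemma finrank_eq_card_leads (e : Basis (Fin N) ℂ V) (S : Submodule ℂ V) :
    finrank ℂ S = (leads e S).card := by
  have := finrank_inf_initial e S N
  rw [initial_of_le e le_rfl, inf_top_eq] at this
  rw [this, below, Finset.filter_true_of_mem fun i _ => i.2]

section Form

variable {B : LinearMap.BilinForm ℂ V} {F : Fin (N + 1) → Submodule ℂ V}
  {e : Basis (Fin N) ℂ V}

lemma IsAdaptedBasis.form_basis (he : IsAdaptedBasis B F e) (i j : Fin N) :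
    B (e i) (e j) = if j = i.rev then 1 else 0 := by
  rw [he.form]
  congr 1
  rw [Fin.ext_iff, Fin.val_rev, eq_iff_iff]
  omega

lemma IsAdaptedBasis.form_eq_sum (he : IsAdaptedBasis B F e) (x y : V) :
    B x y = ∑ i, e.repr x i * e.repr y i.rev := by
  rw [← LinearMap.sum_repr_mul_repr_mul e e, Finsupp.sum_fintype _ _ (by simp)]
  refine Finset.sum_congr rfl fun i _ => ?_
  rw [Finsupp.sum_fintype _ _ (by simp)]
  simp [he.form_basis]

lemma IsAdaptedBasis.form_basis_right (he : IsAdaptedBasis B F e) (x : V) (i : Fin N) :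
    B x (e i) = e.repr x i.rev := by
  rw [he.form_eq_sum, Finset.sum_eq_single i.rev]
  · simp
  · intro j _ hj
    rw [e.repr_self, Finsupp.single_eq_of_ne, mul_zero]
    rintro rfl
    simp at hj
  · simp

/-- A position below `k` has its mirror image at or above `N - k ≥ l`, so every term of the pairing
has a vanishing factor. -/
lemma IsAdaptedBasis.form_eq_zero (he : IsAdaptedBasis B F e) {x y : V} {k l : ℕ} (h : k + l ≤ N)
    (hx : x ∈ initial e k) (hy : y ∈ initial e l) : B x y = 0 := by
  rw [he.form_eq_sum]
  refine Finset.sum_eq_zero fun i _ => ?_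
  by_cases hi : k ≤ i
  · rw [hx i hi, zero_mul]
  · rw [hy i.rev (by rw [Fin.val_rev]; omega), mul_zero]

/-- The leading positions of an isotropic subspace never contain `i` and its mirror image. -/
lemma IsAdaptedBasis.rev_notMem_leads (he : IsAdaptedBasis B F e) {S : Submodule ℂ V}
    (hS : ∀ x ∈ S, ∀ y ∈ S, B x y = 0) {i : Fin N} (hi : i ∈ leads e S) :
    i.rev ∉ leads e S := by
  intro hr
  obtain ⟨u, hu, hu1, hu2⟩ := mem_leads.1 hi
  obtain ⟨w, hw, hw1, hw2⟩ := mem_leads.1 hr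
  have h := hS u hu w hw
  -- Only the product of the two leading coefficients survives: `u` vanishes beyond `i`, and `w`
  -- beyond `i.rev`.
  rw [he.form_eq_sum, Finset.sum_eq_single i] at h
  · exact (mul_ne_zero hu2 hw2) h
  · intro j _ hj
    have hj' : (j : ℕ) ≠ i := fun h => hj (Fin.ext h)
    by_cases hji : (i : ℕ) + 1 ≤ j
    · rw [hu1 j hji, zero_mul]
    · rw [hw1 j.rev (by rw [Fin.val_rev, Fin.val_rev]; omega), mul_zero]
  · simp

/-- The index set formed by the leading positions of an isotropic subspace. -/
noncomputable def leadIndex (he : IsAdaptedBasis B F e) {m : ℕ} (S : OG B m) : IndexSet N m where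
  carrier := leads e S.1
  card_eq := by rw [← finrank_eq_card_leads, S.2.1]
  add_ne := fun i hi j hj h => he.rev_notMem_leads S.2.2 hi (by
    have : j = i.rev := by rw [Fin.ext_iff, Fin.val_rev]; omega
    rwa [← this])

end Form

end

/-! ### Isometries preserving the flag, and their transitivity on cells. -/

section

variable {V : Type*} [AddCommGroup V] [Module ℂ V] {N : ℕ}
variable {B : LinearMap.BilinForm ℂ V} {F : Fin (N + 1) → Submodule ℂ V}
  {e : Basis (Fin N) ℂ V}

/-- The isometries of `V` that stabilize the flag `F`. -/
structure IsFlagIsometry (B : LinearMap.BilinForm ℂ V) (F : Fin (N + 1) → Submodule ℂ V)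
    (g : V ≃ₗ[ℂ] V) : Prop where
  form : ∀ x y, B (g x) (g y) = B x y
  flag : ∀ i, (F i).map (g : V →ₗ[ℂ] V) = F i

lemma IsFlagIsometry.refl : IsFlagIsometry B F (LinearEquiv.refl ℂ V) :=
  ⟨fun _ _ => rfl, fun _ => Submodule.map_id _⟩

lemma IsFlagIsometry.trans {g h : V ≃ₗ[ℂ] V} (hg : IsFlagIsometry B F g)
    (hh : IsFlagIsometry B F h) : IsFlagIsometry B F (g.trans h) :=
  ⟨fun x y => by simp [hg.form, hh.form], fun i => by
    rw [LinearEquiv.coe_trans, Submodule.map_comp, hg.flag, hh.flag]⟩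

lemma IsFlagIsometry.mem_iff {g : V ≃ₗ[ℂ] V} (hg : IsFlagIsometry B F g) (i : Fin (N + 1))
    {x : V} : g x ∈ F i ↔ x ∈ F i := by
  conv_lhs => rw [← hg.flag i]
  constructor
  · rintro ⟨y, hy, h⟩
    rwa [← g.injective h]
  · exact fun h => ⟨x, h, rfl⟩

/-- In odd dimension, every isometry stabilizing the flag acts on subspaces as an element of the
Borel subgroup. -/
lemma IsFlagIsometry.exists_borel (hN : Odd N) (hnd : B.Nondegenerate) (e : Basis (Fin N) ℂ V)
    {g : V ≃ₗ[ℂ] V} (hg : IsFlagIsometry B F g) :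
    ∃ g' ∈ borel B F, ∀ W : Submodule ℂ V,
      W.map (g' : V →ₗ[ℂ] V) = W.map (g : V →ₗ[ℂ] V) := by
  have : FiniteDimensional ℂ V := e.finiteDimensional_of_finite
  have hfr : finrank ℂ V = N := by simpa using finrank_eq_card_basis e
  have hdet : LinearMap.det (g : V →ₗ[ℂ] V) * LinearMap.det (g : V →ₗ[ℂ] V) = 1 := by
    have hM := (LinearMap.BilinForm.nondegenerate_iff_det_ne_zero e).1 hnd
    have hc : B.comp (g : V →ₗ[ℂ] V) (g : V →ₗ[ℂ] V) = B := by
      ext x y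
      simp [hg.form]
    have h := congrArg Matrix.det (LinearMap.BilinForm.toMatrix_comp e e B (g : V →ₗ[ℂ] V) (g : V →ₗ[ℂ] V))
    rw [hc, Matrix.det_mul, Matrix.det_mul, Matrix.det_transpose, LinearMap.det_toMatrix] at h
    apply mul_right_cancel₀ hM
    linear_combination -h
  rcases mul_self_eq_one_iff.1 hdet with h | h
  · refine ⟨g, ⟨⟨hg.form, Units.ext ?_⟩, hg.flag⟩, fun _ => rfl⟩
    rw [LinearEquiv.coe_det, h, Units.val_one]
  -- If the determinant is `-1`, pass to `-g`: it acts identically on subspaces, and odd `N` flips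
  -- the determinant.
  · have hmap : ∀ W : Submodule ℂ V, W.map ((g.trans (LinearEquiv.neg ℂ) : V ≃ₗ[ℂ] V) : V →ₗ[ℂ] V)
        = W.map (g : V →ₗ[ℂ] V) := by
      intro W
      ext x
      constructor
      · rintro ⟨y, hy, rfl⟩
        exact ⟨-y, W.neg_mem hy, by simp⟩
      · rintro ⟨y, hy, rfl⟩
        exact ⟨-y, W.neg_mem hy, by simp⟩
    refine ⟨g.trans (LinearEquiv.neg ℂ), ⟨⟨fun x y => by simp [hg.form], Units.ext ?_⟩,
      fun i => (hmap _).trans (hg.flag i)⟩, hmap⟩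
    have hneg : ((g.trans (LinearEquiv.neg ℂ) : V ≃ₗ[ℂ] V) : V →ₗ[ℂ] V)
        = (-1 : ℂ) • (g : V →ₗ[ℂ] V) := by
      ext x
      simp
    rw [LinearEquiv.coe_det, hneg, LinearMap.det_smul, h, hfr, hN.neg_one_pow]
    simp

lemma isFlagIsometry_of_mem_borel {g : V ≃ₗ[ℂ] V} (hg : g ∈ borel B F) : IsFlagIsometry B F g :=
  ⟨hg.1.1, hg.2⟩

/-- The Eichler transformation attached to an isotropic vector `f` and a vector `a ⟂ f`. -/
noncomputable def eichler (B : LinearMap.BilinForm ℂ V) (f a : V) : V →ₗ[ℂ] V :=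
  LinearMap.id + (B.flip f).smulRight a - (B.flip a).smulRight f
    - (B a a / 2) • (B.flip f).smulRight f

lemma eichler_apply (f a x : V) :
    eichler B f a x = x + B x f • a - B x a • f - (B a a / 2 * B x f) • f := by
  simp [eichler, mul_smul]

/-- The coefficient `B a a / 2` is chosen so that its two cross terms cancel the contribution `B x f
* B y f * B a a`. -/
lemma eichler_form (hB : B.IsSymm) {f a : V} (hf : B f f = 0) (ha : B a f = 0) (x y : V) :
    B (eichler B f a x) (eichler B f a y) = B x y := by
  have h1 : B f a = 0 := by rw [hB.eq, ha]
  simp only [eichler_apply, map_add, map_sub, map_smul, LinearMap.add_apply, LinearMap.sub_apply,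
    LinearMap.smul_apply, smul_eq_mul, hf, ha, h1, hB.eq f y, hB.eq a y]
  ring

/-- An isotropic vector with leading term `e q` is the image of `e q` under a flag isometry fixing
all vectors orthogonal to the relevant data. -/
lemma exists_isFlagIsometry_apply (hB : B.IsSymm) (hnd : B.Nondegenerate)
    (he : IsAdaptedBasis B F e) {q : Fin N} (hq : q.rev ≠ q) {u : V} (hu : B u u = 0)
    (huq : u ∈ initial e (q + 1)) (h1 : e.repr u q = 1) :
    ∃ g : V ≃ₗ[ℂ] V, IsFlagIsometry B F g ∧ g (e q) = u ∧
      ∀ x, B x u = 0 → B x (e q) = 0 → B x (e q.rev) = 0 → g x = x := by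
  have : FiniteDimensional ℂ V := e.finiteDimensional_of_finite
  set f := e q.rev with hf
  set a := u - e q with ha
  have hq' : (q.rev : ℕ) ≠ q := fun h => hq (Fin.ext h)
  have hff : B f f = 0 := by
    rw [he.form_basis, if_neg]
    rw [Fin.rev_rev]
    exact hq
  have hef : B (e q) f = 1 := by rw [he.form_basis, if_pos rfl]
  have hee : B (e q) (e q) = 0 := by rw [he.form_basis, if_neg hq.symm]
  have haf : B a f = 0 := by
    rw [ha, map_sub, LinearMap.sub_apply, hef, he.form_basis_right, Fin.rev_rev, h1, sub_self]
  have haq : a ∈ initial e q :=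
    (initial_succ_inf_ker e q).2 ⟨sub_mem huq (basis_mem_initial e (Nat.lt_succ_self _)), by
      simp [ha, h1]⟩
  have hform := eichler_form hB hff haf
  have hinj : Function.Injective (eichler B f a) := by
    rw [← LinearMap.ker_eq_bot, eq_bot_iff]
    intro x hx
    refine hnd.1 x fun y => ?_
    rw [← hform, LinearMap.mem_ker.1 hx, map_zero, LinearMap.zero_apply]
  -- The coefficient `B x f` is the `q`-th coordinate of `x`, so it vanishes unless `q < i`, and
  -- then `a ∈ F_q ⊆ F_i`. A multiple of `f` appears only if the relevant pairing with `a` is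
  -- nonzero, which forces `q.rev < i`.
  have hflag : ∀ i, ∀ x ∈ F i, eichler B f a x ∈ F i := by
    intro i x hx
    rw [he.flag_eq] at hx ⊢
    rw [eichler_apply]
    have hxf : (i : ℕ) ≤ q → B x f = 0 := fun h => by
      rw [he.form_basis_right, Fin.rev_rev, hx q h]
    refine sub_mem (sub_mem (add_mem hx ?_) ?_) ?_
    · by_cases h : (i : ℕ) ≤ q
      · rw [hxf h, zero_smul]
        exact zero_mem _
      · exact Submodule.smul_mem _ _ (initial_mono e (by omega) haq)
    · by_cases h : (i : ℕ) + q ≤ N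
      · rw [he.form_eq_zero h hx haq, zero_smul]
        exact zero_mem _
      · exact Submodule.smul_mem _ _ (basis_mem_initial e (by rw [Fin.val_rev]; omega))
    · by_cases h : (i : ℕ) ≤ q
      · rw [hxf h, mul_zero, zero_smul]
        exact zero_mem _
      · by_cases h' : (q : ℕ) + q ≤ N
        · rw [he.form_eq_zero h' haq haq, zero_div, zero_mul, zero_smul]
          exact zero_mem _
        · exact Submodule.smul_mem _ _ (basis_mem_initial e (by rw [Fin.val_rev]; omega))
  refine ⟨LinearEquiv.ofInjectiveEndo _ hinj, ⟨hform, fun i => ?_⟩, ?_, ?_⟩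
  · refine Submodule.eq_of_le_of_finrank_eq (Submodule.map_le_iff_le_comap.2 (hflag i)) ?_
    exact LinearEquiv.finrank_map_eq _ _
  · change eichler B f a (e q) = u
    -- Isotropy of `u = e q + a` makes the two `f`-terms of the Eichler image of `e q` cancel.
    have h2 : B a a = -2 * B (e q) a := by
      simp only [ha, map_sub, LinearMap.sub_apply, hu, hee, hB.eq u (e q)]
      ring
    rw [eichler_apply, hef, h2, ha]
    module
  · intro x hxu hxe hxf
    change eichler B f a x = x
    rw [eichler_apply, hxf, ha, map_sub, hxu, hxe]
    simp

/-- A subspace having all elements of `P` as leading positions lies in the cell of `P`. -/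
lemma mem_schubertCell (hN : Odd N) (hB : B.IsSymm) (hnd : B.Nondegenerate)
    (he : IsAdaptedBasis B F e) {m : ℕ} (P : IndexSet N m) (S : OG B m)
    (h : P.carrier ⊆ leads e S.1) : S ∈ schubertCell B F e P := by
  have : FiniteDimensional ℂ V := e.finiteDimensional_of_finite
  have key : ∀ A : Finset (Fin N), A ⊆ P.carrier →
      ∃ g : V ≃ₗ[ℂ] V, IsFlagIsometry B F g ∧ ∀ q ∈ A, g (e q) ∈ S.1 := by
    intro A
    induction A using Finset.induction_on with
    | empty => exact fun _ => ⟨_, IsFlagIsometry.refl, by simp⟩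
    | insert q A hqA ih =>
      intro hA
      obtain ⟨g, hg, hgA⟩ := ih ((Finset.subset_insert _ _).trans hA)
      have hqP : q ∈ P.carrier := hA (Finset.mem_insert_self _ _)
      obtain ⟨u, hu, hu1, hu2⟩ := mem_leads.1 (h hqP)
      have hw1 : g.symm u ∈ initial e (q + 1) := by
        have := hg.mem_iff q.succ (x := g.symm u)
        rw [g.apply_symm_apply, he.flag_eq] at this
        exact this.1 hu1
      have hw2 : e.repr (g.symm u) q ≠ 0 := by
        intro h0
        have h2 : g.symm u ∈ initial e q := (initial_succ_inf_ker e q).2 ⟨hw1, h0⟩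
        have := hg.mem_iff q.castSucc (x := g.symm u)
        rw [g.apply_symm_apply, he.flag_eq] at this
        exact hu2 (this.2 h2 q le_rfl)
      set c := e.repr (g.symm u) q with hc
      set w := c⁻¹ • g.symm u with hw
      have hgw : g w ∈ S.1 := by
        rw [hw, map_smul, g.apply_symm_apply]
        exact S.1.smul_mem _ hu
      have hrev : ∀ i ∈ P.carrier, ∀ j ∈ P.carrier, j ≠ i.rev := by
        rintro i hi j hj rfl
        refine P.add_ne i hi _ hj ?_
        rw [Fin.val_rev]
        omega
      -- Pulling back by `g` keeps the leading position `q`. The new map `k` is applied before `g`;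
      -- it fixes the `e i` already treated, which are orthogonal to `w` because `g (e i)` and `g w`
      -- both lie in the isotropic `S`.
      obtain ⟨k, hk, hkq, hkx⟩ := exists_isFlagIsometry_apply hB hnd he (q := q) (u := w)
        (fun h => hrev q hqP q hqP h.symm) (by rw [← hg.form]; exact S.2.2 _ hgw _ hgw)
        (Submodule.smul_mem _ _ hw1) (by simp [hw, ← hc, hw2])
      refine ⟨k.trans g, hk.trans hg, fun i hi => ?_⟩
      rw [LinearEquiv.trans_apply]
      rcases Finset.mem_insert.1 hi with rfl | hi'
      · rwa [hkq]
      · have hiP : i ∈ P.carrier := hA hi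
        rw [hkx]
        · exact hgA i hi'
        · rw [← hg.form]
          exact S.2.2 _ (hgA i hi') _ hgw
        · rw [he.form_basis, if_neg (hrev i hiP q hqP)]
        · rw [he.form_basis, if_neg]
          intro h
          exact hqA (Fin.rev_injective h ▸ hi')
  obtain ⟨g, hg, hgP⟩ := key _ subset_rfl
  obtain ⟨g', hg', hmap⟩ := hg.exists_borel hN hnd e
  refine ⟨g', hg', ?_⟩
  rw [hmap]
  symm
  refine Submodule.eq_of_le_of_finrank_eq ?_ ?_
  · rw [Submodule.map_span, Submodule.span_le]
    rintro _ ⟨_, ⟨q, hq, rfl⟩, rfl⟩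
    exact hgP q hq
  · rw [S.2.1, LinearEquiv.finrank_map_eq, Set.image_eq_range, finrank_span_eq_card]
    · simp [P.card_eq]
    · exact e.linearIndependent.comp _ Subtype.val_injective

end

/-! ### Zariski topology: limits along curves and semicontinuity. -/

section

variable {V : Type*} [AddCommGroup V] [Module ℂ V] {N m : ℕ}
variable {B : LinearMap.BilinForm ℂ V} {F : Fin (N + 1) → Submodule ℂ V}
  {e : Basis (Fin N) ℂ V}

lemma eval_smul_of_isHomogeneous {σ : Type*} {f : MvPolynomial σ ℂ} {d : ℕ}
    (hf : f.IsHomogeneous d) (c : ℂ) (x : σ → ℂ) :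
    MvPolynomial.eval (fun i => c * x i) f = c ^ d * MvPolynomial.eval x f := by
  rw [MvPolynomial.eval_eq, MvPolynomial.eval_eq, Finset.mul_sum]
  refine Finset.sum_congr rfl fun k hk => ?_
  have hd : ∑ i ∈ k.support, k i = d := by
    have := hf (MvPolynomial.mem_support_iff.1 hk)
    rw [← this, Finsupp.weight_apply, Finsupp.sum]
    simp
  simp only [mul_pow, Finset.prod_mul_distrib, Finset.prod_pow_eq_pow_sum, hd]
  ring

lemma pluecker_basis_change {S : Submodule ℂ V} (v w : Basis (Fin m) ℂ S)
    (φ : Fin m → Dual ℂ V) :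
    pluecker (fun b => (w b : V)) φ = (v.toMatrix w).det * pluecker (fun b => (v b : V)) φ := by
  rw [pluecker, pluecker, mul_comm, ← Matrix.det_mul]
  congr 1
  ext a b
  rw [Matrix.mul_apply, Matrix.of_apply]
  let ψ : S →ₗ[ℂ] ℂ := (φ a).comp S.subtype
  change ψ (w b) = _
  rw [← v.sum_toMatrix_smul_self w b, map_sum]
  refine Finset.sum_congr rfl fun i _ => ?_
  rw [map_smul, smul_eq_mul, mul_comm]
  rfl

/-- Nonvanishing of a homogeneous polynomial in the Plücker coordinates can be tested on any
basis. -/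
lemma eval_pluecker_ne_zero {S : OG B m} {f : MvPolynomial (Fin m → Dual ℂ V) ℂ} {d : ℕ}
    (hf : f.IsHomogeneous d) (hS : S ∈ nonvanishing B m f) (v : Basis (Fin m) ℂ S.1) :
    MvPolynomial.eval (pluecker fun b => (v b : V)) f ≠ 0 := by
  obtain ⟨w, hw⟩ := hS
  have : pluecker (fun b => (w b : V)) =
      fun φ => (v.toMatrix w).det * pluecker (fun b => (v b : V)) φ :=
    funext (pluecker_basis_change v w)
  rw [this, eval_smul_of_isHomogeneous hf] at hw
  exact right_ne_zero_of_mul hw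

/-- The point of the orthogonal Grassmannian given by independent isotropic vectors. -/
noncomputable def spanPoint (v : Fin m → V) (hv : LinearIndependent ℂ v)
    (hB : ∀ i j, B (v i) (v j) = 0) : OG B m :=
  ⟨Submodule.span ℂ (Set.range v), by rw [finrank_span_eq_card hv, Fintype.card_fin], by
    intro x hx y hy
    induction hx using Submodule.span_induction with
    | mem x hx =>
      obtain ⟨i, rfl⟩ := hx
      induction hy using Submodule.span_induction with
      | mem y hy =>
        obtain ⟨j, rfl⟩ := hy
        exact hB i j
      | zero => simp
      | add y z _ _ h1 h2 => simp [h1, h2]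
      | smul c y _ h => simp [h]
    | zero => simp
    | add y z _ _ h1 h2 => simp [h1, h2]
    | smul c y _ h => simp [h]⟩

/-- The limit of a continuous family of independent isotropic vectors. -/
lemma spanPoint_mem_closure {A : Set (OG B m)} (w : ℂ → Fin m → V)
    (hw : ∀ s, LinearIndependent ℂ (w s)) (hB : ∀ s i j, B (w s i) (w s j) = 0)
    (hcont : ∀ (φ : Dual ℂ V) j, Continuous fun s => φ (w s j))
    (hA : ∀ s, s ≠ 0 → spanPoint (w s) (hw s) (hB s) ∈ A) :
    spanPoint (w 0) (hw 0) (hB 0) ∈ closure A := by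
  -- The parameter `s` carries the Euclidean topology. Plücker coordinates are continuous in `s`, so
  -- nonvanishing at `0` persists nearby, and testing the generating open sets suffices.
  refine mem_closure_of_tendsto (f := fun s => spanPoint (w s) (hw s) (hB s))
    (b := nhdsWithin (0 : ℂ) {0}ᶜ) ?_ (eventually_nhdsWithin_of_forall fun s hs => hA s hs)
  refine TopologicalSpace.tendsto_nhds_generateFrom_iff.2 ?_
  rintro _ ⟨d, f, hf, rfl⟩ h0
  have hbasis : ∀ s, (fun b => ((Basis.span (hw s) b : Submodule.span ℂ (Set.range (w s))) : V))
      = w s := fun s => funext fun b => congrArg Subtype.val (Basis.span_apply (hw s) b)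
  have h1 : MvPolynomial.eval (pluecker (w 0)) f ≠ 0 := by
    rw [← hbasis 0]
    exact eval_pluecker_ne_zero hf h0 (Basis.span (hw 0))
  have hc : Continuous fun s => MvPolynomial.eval (pluecker (w s)) f := by
    refine (MvPolynomial.continuous_eval f).comp (continuous_pi fun φ => ?_)
    exact Continuous.matrix_det (continuous_matrix fun a b => hcont _ _)
  have h2 : ∀ᶠ s in nhdsWithin (0 : ℂ) {0}ᶜ, MvPolynomial.eval (pluecker (w s)) f ≠ 0 :=
    (hc.continuousAt.eventually_ne h1).filter_mono nhdsWithin_le_nhds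
  filter_upwards [h2] with s hs
  rw [← hbasis s] at hs
  exact ⟨Basis.span (hw s), hs⟩

lemma IndexSet.elem_mem (P : IndexSet N m) (j : Fin m) : P.elem j ∈ P.carrier :=
  Finset.orderEmbOfFin_mem _ _ _

lemma IndexSet.range_elem (P : IndexSet N m) : Set.range P.elem = P.carrier :=
  Finset.range_orderEmbOfFin _ _

lemma IndexSet.exists_elem (P : IndexSet N m) {p : Fin N} (hp : p ∈ P.carrier) :
    ∃ j, P.elem j = p := by
  have : p ∈ Set.range P.elem := by rw [P.range_elem]; exact hp
  exact this

lemma subset_leads_span (P : IndexSet N m) {v : Fin m → V}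
    (h1 : ∀ j, v j ∈ initial e (P.elem j + 1)) (h2 : ∀ j, v j ∉ initial e (P.elem j)) :
    P.carrier ⊆ leads e (Submodule.span ℂ (Set.range v)) := by
  intro p hp
  obtain ⟨j, rfl⟩ := P.exists_elem hp
  exact mem_leads.2 ⟨v j, Submodule.subset_span ⟨j, rfl⟩, h1 j,
    fun h0 => h2 j ((initial_succ_inf_ker e _).2 ⟨h1 j, h0⟩)⟩

/-- The span has at least `m` leading positions, hence dimension at least `m`. -/
lemma linearIndependent_of_leads (P : IndexSet N m) {v : Fin m → V}
    (h1 : ∀ j, v j ∈ initial e (P.elem j + 1)) (h2 : ∀ j, v j ∉ initial e (P.elem j)) :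
    LinearIndependent ℂ v := by
  rw [linearIndependent_iff_card_le_finrank_span, Set.finrank, finrank_eq_card_leads e,
    Fintype.card_fin]
  exact P.card_eq.symm.le.trans (Finset.card_le_card (subset_leads_span P h1 h2))

/-- Limits of curves in a Schubert cell. -/
lemma span_mem_schubertVariety (hN : Odd N) (hB : B.IsSymm) (hnd : B.Nondegenerate)
    (he : IsAdaptedBasis B F e) (P : IndexSet N m) (w : ℂ → Fin m → V)
    (hw0 : LinearIndependent ℂ (w 0)) (hwB : ∀ s i j, B (w s i) (w s j) = 0)
    (hcont : ∀ (φ : Dual ℂ V) j, Continuous fun s => φ (w s j))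
    (h1 : ∀ s, s ≠ 0 → ∀ j, w s j ∈ initial e (P.elem j + 1))
    (h2 : ∀ s, s ≠ 0 → ∀ j, w s j ∉ initial e (P.elem j)) :
    spanPoint (w 0) hw0 (hwB 0) ∈ schubertVariety B F e P := by
  have hw : ∀ s, LinearIndependent ℂ (w s) := fun s => by
    by_cases hs : s = 0
    · rwa [hs]
    · exact linearIndependent_of_leads P (h1 s hs) (h2 s hs)
  exact spanPoint_mem_closure w hw hwB hcont fun s hs =>
    mem_schubertCell hN hB hnd he P _ (subset_leads_span P (h1 s hs) (h2 s hs))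

/-- If the coordinate vectors of `P'` are a limit of vectors with leading positions in `P`, then
the cell of `P'` lies in the Schubert variety of `P`. -/
lemma schubertCell_subset_of_curve (hN : Odd N) (hB : B.IsSymm) (hnd : B.Nondegenerate)
    (he : IsAdaptedBasis B F e) (P P' : IndexSet N m) (w : ℂ → Fin N → V)
    (hwB : ∀ s, ∀ i ∈ P.carrier, ∀ j ∈ P.carrier, B (w s i) (w s j) = 0)
    (hcont : ∀ (φ : Dual ℂ V) j, Continuous fun s => φ (w s j))
    (h1 : ∀ s, s ≠ 0 → ∀ j ∈ P.carrier, w s j ∈ initial e (j + 1))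
    (h2 : ∀ s, s ≠ 0 → ∀ j ∈ P.carrier, e.repr (w s j) j ≠ 0)
    (σ : Fin N → Fin N) (hσ : P'.carrier = P.carrier.image σ)
    (c : Fin N → ℂ) (hc : ∀ j, c j ≠ 0) (h0 : ∀ j ∈ P.carrier, w 0 j = c j • e (σ j)) :
    schubertCell B F e P' ⊆ schubertVariety B F e P := by
  rintro S ⟨g, hg, hS⟩
  have hgi := isFlagIsometry_of_mem_borel hg
  have hinj : Set.InjOn σ P.carrier := by
    rw [← Finset.card_image_iff, ← hσ, P.card_eq, P'.card_eq]
  have hind : LinearIndependent ℂ fun j => w 0 (P.elem j) := by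
    have h3 : LinearIndependent ℂ fun j => e (σ (P.elem j)) :=
      e.linearIndependent.comp (fun j => σ (P.elem j)) fun i j h =>
        P.elem.injective (hinj (P.elem_mem i) (P.elem_mem j) h)
    convert h3.units_smul fun j => Units.mk0 (c (P.elem j)) (hc _) using 1
    ext j
    rw [h0 _ (P.elem_mem j)]
    rfl
  have hstab : ∀ (k : Fin (N + 1)) x, g x ∈ initial e k ↔ x ∈ initial e k := fun k x => by
    rw [← he.flag_eq]
    exact hgi.mem_iff k
  -- Translating the curve by `g` preserves isotropy and leading positions, so one curve at the
  -- coordinate point serves the whole cell.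
  have key := span_mem_schubertVariety hN hB hnd he P (fun s j => g (w s (P.elem j)))
    (hind.map' (g : V →ₗ[ℂ] V) g.ker)
    (fun s i j => by rw [hgi.form]; exact hwB s _ (P.elem_mem i) _ (P.elem_mem j))
    (fun φ j => hcont (φ.comp (g : V →ₗ[ℂ] V)) _)
    (fun s hs j => (hstab (P.elem j).succ _).2 (h1 s hs _ (P.elem_mem j)))
    (fun s hs j h => h2 s hs _ (P.elem_mem j) ((hstab (P.elem j).castSucc _).1 h _ le_rfl))
  convert key
  refine Subtype.ext ?_
  rw [hS]
  change _ = Submodule.span ℂ (Set.range fun j => g (w 0 (P.elem j)))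
  have hr : (Set.range fun j => g (w 0 (P.elem j))) =
      (g : V →ₗ[ℂ] V) '' ((fun i => w 0 i) '' P.carrier) := by
    rw [← P.range_elem, ← Set.range_comp, ← Set.range_comp]
    rfl
  rw [hr, ← Submodule.map_span]
  congr 1
  rw [hσ]
  apply le_antisymm
  · rw [Submodule.span_le]
    rintro _ ⟨i, hi, rfl⟩
    obtain ⟨j, hj, rfl⟩ := Finset.mem_image.1 (Finset.mem_coe.1 hi)
    have : e (σ j) = (c j)⁻¹ • w 0 j := by rw [h0 j hj, inv_smul_smul₀ (hc j)]
    rw [this]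
    exact Submodule.smul_mem _ _ (Submodule.subset_span ⟨j, hj, rfl⟩)
  · rw [Submodule.span_le]
    rintro _ ⟨j, hj, rfl⟩
    change w 0 j ∈ _
    rw [h0 j hj]
    exact Submodule.smul_mem _ _ (Submodule.subset_span
      ⟨σ j, Finset.mem_coe.2 (Finset.mem_image_of_mem _ hj), rfl⟩)

/-- Dimensions of intersections with the flag are upper semicontinuous at points of a cell. -/
lemma exists_isOpen_finrank_le (he : IsAdaptedBasis B F e) (Q : IndexSet N m) {S : OG B m}
    (hS : S ∈ schubertCell B F e Q) :
    ∃ U : Set (OG B m), IsOpen U ∧ S ∈ U ∧ ∀ T ∈ U, ∀ k : Fin (N + 1),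
      finrank ℂ (T.1 ⊓ F k : Submodule ℂ V) ≤ (below Q.carrier k).card := by
  have : FiniteDimensional ℂ V := e.finiteDimensional_of_finite
  obtain ⟨g, hg, hS⟩ := hS
  have hgi := isFlagIsometry_of_mem_borel hg
  -- Dual coordinates on `Q`, transported by `g`; their Plücker matrix at `S` is the identity.
  let φ : Fin m → Dual ℂ V := fun a => (e.coord (Q.elem a)).comp (g.symm : V →ₗ[ℂ] V)
  refine ⟨nonvanishing B m (MvPolynomial.X φ), TopologicalSpace.isOpen_generateFrom_of_mem
    ⟨1, _, MvPolynomial.isHomogeneous_X _ _, rfl⟩, ?_, ?_⟩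
  · have hv : LinearIndependent ℂ fun j => g (e (Q.elem j)) :=
      (e.linearIndependent.comp _ Q.elem.injective).map' (g : V →ₗ[ℂ] V) g.ker
    have hspan : Submodule.span ℂ (Set.range fun j => g (e (Q.elem j))) = S.1 := by
      rw [hS, Submodule.map_span, ← Q.range_elem, ← Set.range_comp, ← Set.range_comp]
      rfl
    refine ⟨(Basis.span hv).map (LinearEquiv.ofEq _ _ hspan), ?_⟩
    rw [MvPolynomial.eval_X, pluecker]
    have : (Matrix.of fun a b => φ a
        (((Basis.span hv).map (LinearEquiv.ofEq _ _ hspan) b : S.1) : V)) = 1 := by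
      ext a b
      rw [Matrix.of_apply, Basis.map_apply, LinearEquiv.coe_ofEq_apply, Basis.span_apply]
      simp [φ, Matrix.one_apply, Finsupp.single_apply, eq_comm]
    rw [this, Matrix.det_one]
    exact one_ne_zero
  · rintro T ⟨v, hv⟩ k
    rw [MvPolynomial.eval_X, pluecker] at hv
    let A := {a : Fin m // (Q.elem a : ℕ) < k}
    -- On `T` the forms `φ a` are jointly injective, and those with position at least `k` vanish on
    -- `F k`; the remaining ones bound the dimension.
    let ψ : (T.1 ⊓ F k : Submodule ℂ V) →ₗ[ℂ] (A → ℂ) :=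
      LinearMap.pi fun a => (φ a.1).comp (Submodule.subtype _)
    have hinj : Function.Injective ψ := by
      rw [← LinearMap.ker_eq_bot, eq_bot_iff]
      rintro ⟨x, hxT, hxF⟩ hx
      have hφ : ∀ a, φ a x = 0 := by
        intro a
        by_cases ha : (Q.elem a : ℕ) < k
        · exact congrFun (LinearMap.mem_ker.1 hx) ⟨a, ha⟩
        · have h1 : g.symm x ∈ F k := by
            rw [← hgi.mem_iff, g.apply_symm_apply]
            exact hxF
          rw [he.flag_eq] at h1
          exact h1 _ (not_lt.1 ha)
      have hz : v.repr ⟨x, hxT⟩ = 0 := by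
        have hmul : (Matrix.of fun a b => φ a (v b : V)).mulVec (v.repr ⟨x, hxT⟩) = 0 := by
          ext a
          let θ : T.1 →ₗ[ℂ] ℂ := (φ a).comp T.1.subtype
          have hθ : θ ⟨x, hxT⟩ = 0 := hφ a
          rw [← v.sum_repr ⟨x, hxT⟩, map_sum] at hθ
          refine Eq.trans ?_ hθ
          rw [Matrix.mulVec, dotProduct]
          refine Finset.sum_congr rfl fun i _ => ?_
          rw [map_smul, smul_eq_mul, mul_comm]
          rfl
        exact DFunLike.coe_injective (Matrix.eq_zero_of_mulVec_eq_zero hv hmul)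
      have h0 : x = 0 := congrArg Subtype.val (v.repr.map_eq_zero_iff.1 hz)
      exact Subtype.ext h0
    have hle := LinearMap.finrank_le_finrank_of_injective hinj
    rw [finrank_pi] at hle
    refine hle.trans ?_
    rw [← Fintype.card_coe]
    refine Fintype.card_le_of_injective (fun a => ⟨Q.elem a.1, mem_below.2 ⟨Q.elem_mem _, a.2⟩⟩) ?_
    intro a b hab
    simp only [Subtype.mk.injEq] at hab
    exact Subtype.ext (Q.elem.injective hab)

end

/-! ### Combinatorics of index sets and elementary steps. -/

section

variable {N m : ℕ}

lemma IndexSet.ne_rev (P : IndexSet N m) {i j : Fin N} (hi : i ∈ P.carrier) (hj : j ∈ P.carrier) :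
    j ≠ i.rev := by
  rintro rfl
  refine P.add_ne i hi _ hj ?_
  rw [Fin.val_rev]
  omega

/-- An index set is an `m`-element set that does not contain mirror images of its elements. -/
def IndexSet.ofRev (A : Finset (Fin N)) (hA : A.card = m) (h : ∀ i ∈ A, i.rev ∉ A) :
    IndexSet N m where
  carrier := A
  card_eq := hA
  add_ne := fun i hi j hj hij => h i hi (by
    have : j = i.rev := by rw [Fin.ext_iff, Fin.val_rev]; omega
    rwa [← this])

lemma IndexSet.lt_card_below_iff (P : IndexSet N m) (j : Fin m) (k : ℕ) :
    (j : ℕ) < (below P.carrier k).card ↔ (P.elem j : ℕ) < k := by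
  constructor
  · intro h
    by_contra hk
    have hsub : below P.carrier k ⊆ (Finset.Iio j).image P.elem := by
      intro p hp
      rw [mem_below] at hp
      obtain ⟨i, rfl⟩ := P.exists_elem hp.1
      refine Finset.mem_image_of_mem _ (Finset.mem_Iio.2 (P.elem.lt_iff_lt.1 ?_))
      rw [Fin.lt_def]
      omega
    have := (Finset.card_le_card hsub).trans Finset.card_image_le
    rw [Fin.card_Iio] at this
    omega
  · intro h
    have hsub : (Finset.Iic j).image P.elem ⊆ below P.carrier k := by
      intro p hp
      obtain ⟨i, hi, rfl⟩ := Finset.mem_image.1 hp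
      have : P.elem i ≤ P.elem j := P.elem.le_iff_le.2 (Finset.mem_Iic.1 hi)
      rw [Fin.le_def] at this
      exact mem_below.2 ⟨P.elem_mem i, by omega⟩
    have := Finset.card_le_card hsub
    rw [Finset.card_image_of_injective _ P.elem.injective, Fin.card_Iic] at this
    omega

/-- In this form, replacing elements changes the counts by indicator functions of intervals. -/
lemma IndexSet.le_iff_card_below (Q P : IndexSet N m) :
    Q ≤ P ↔ ∀ k, (below P.carrier k).card ≤ (below Q.carrier k).card := by
  constructor
  · intro h k
    by_contra! hk
    have hm : (below P.carrier k).card ≤ m :=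
      (Finset.card_le_card (Finset.filter_subset _ _)).trans P.card_eq.le
    let j : Fin m := ⟨(below Q.carrier k).card, by omega⟩
    have h1 := (P.lt_card_below_iff j k).1 hk
    have h2 : Q.elem j ≤ P.elem j := h j
    rw [Fin.le_def] at h2
    have := (Q.lt_card_below_iff j k).2 (by omega)
    exact lt_irrefl _ this
  · intro h j
    have h1 := (P.lt_card_below_iff j _).2 (Nat.lt_succ_self _)
    have h2 := (Q.lt_card_below_iff j _).1 (h1.trans_le (h _))
    rw [Fin.le_def]
    omega

lemma card_below_eq_sum (A : Finset (Fin N)) (k : ℕ) :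
    (below A k).card = ∑ i ∈ A, if (i : ℕ) < k then 1 else 0 := Finset.card_filter _ _

lemma card_below_succ (A : Finset (Fin N)) (i : Fin N) :
    (below A (i + 1)).card = (below A i).card + if i ∈ A then 1 else 0 := by
  have : ∀ j : Fin N, (if (j : ℕ) < i + 1 then 1 else 0 : ℕ)
      = (if (j : ℕ) < i then 1 else 0) + if i = j then 1 else 0 := by
    intro j
    simp only [Fin.ext_iff]
    split_ifs <;> omega
  simp only [card_below_eq_sum, this, Finset.sum_add_distrib, Finset.sum_ite_eq]

lemma card_below_mono (A : Finset (Fin N)) {k l : ℕ} (h : k ≤ l) :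
    (below A k).card ≤ (below A l).card := by
  refine Finset.card_le_card fun i hi => ?_
  rw [mem_below] at hi ⊢
  exact ⟨hi.1, by omega⟩

/-- One elementary step down from `P` to `P'`: either one element of `P` is replaced by a smaller
one, or two elements `p, r` are replaced by their mirror images in exchanged order. -/
def IsStep (P P' : IndexSet N m) : Prop :=
  (∃ p ∈ P.carrier, ∃ p' < p, p' ∉ P.carrier ∧ p'.rev ≠ p' ∧ p'.rev ∉ P.carrier.erase p ∧
    P'.carrier = insert p' (P.carrier.erase p)) ∨
  (∃ p ∈ P.carrier, ∃ r ∈ P.carrier, r ≠ p ∧ r.rev < p ∧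
    P'.carrier = insert r.rev (insert p.rev ((P.carrier.erase p).erase r)))

/-- Written without subtraction; `f` is later an indicator (for counts) or the position itself (for
the decreasing sum). -/
lemma sum_replace {A : Finset (Fin N)} {p p' : Fin N} (hp : p ∈ A) (hp' : p' ∉ A)
    (f : Fin N → ℕ) :
    f p + ∑ i ∈ insert p' (A.erase p), f i = f p' + ∑ i ∈ A, f i := by
  rw [Finset.sum_insert fun h => hp' (Finset.mem_of_mem_erase h), ← Finset.add_sum_erase A f hp]
  omega

lemma sum_replace_two {A : Finset (Fin N)} {p r p' r' : Fin N} (hp : p ∈ A) (hr : r ∈ A)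
    (hpr : r ≠ p) (hp' : p' ∉ A) (hr' : r' ∉ A) (hpr' : r' ≠ p') (f : Fin N → ℕ) :
    f p + f r + ∑ i ∈ insert r' (insert p' ((A.erase p).erase r)), f i
      = f p' + f r' + ∑ i ∈ A, f i := by
  rw [Finset.sum_insert, Finset.sum_insert, ← Finset.add_sum_erase A f hp,
    ← Finset.add_sum_erase (A.erase p) f (Finset.mem_erase.2 ⟨hpr, hr⟩)]
  · omega
  · exact fun h => hp' (Finset.mem_of_mem_erase (Finset.mem_of_mem_erase h))
  · intro h
    rcases Finset.mem_insert.1 h with h | h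
    · exact hpr' h
    · exact hr' (Finset.mem_of_mem_erase (Finset.mem_of_mem_erase h))

/-- The replacement raises the count of `P` by one exactly for `p' < k ≤ p`, where `hk` provides the
slack. -/
lemma exists_isStep_single (P Q : IndexSet N m)
    (hle : ∀ k, (below P.carrier k).card ≤ (below Q.carrier k).card)
    {p p' : Fin N} (hp : p ∈ P.carrier) (hlt : p' < p) (hp' : p' ∉ P.carrier) (hpr : p'.rev ≠ p')
    (hrev : p'.rev ∉ P.carrier.erase p)
    (hk : ∀ k : ℕ, (p' : ℕ) < k → k ≤ p → (below P.carrier k).card < (below Q.carrier k).card) :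
    ∃ P', IsStep P P' ∧ Q ≤ P' ∧ ∑ i ∈ P'.carrier, (i : ℕ) < ∑ i ∈ P.carrier, (i : ℕ) := by
  have hcard : (insert p' (P.carrier.erase p)).card = m := by
    rw [Finset.card_insert_of_notMem fun h => hp' (Finset.mem_of_mem_erase h),
      Finset.card_erase_add_one hp, P.card_eq]
  have hindex : ∀ i ∈ insert p' (P.carrier.erase p), i.rev ∉ insert p' (P.carrier.erase p) := by
    intro i hi hir
    rcases Finset.mem_insert.1 hi with rfl | hi
    · rcases Finset.mem_insert.1 hir with h | h
      · exact hpr h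
      · exact hrev h
    · rcases Finset.mem_insert.1 hir with h | h
      · rw [← h, Fin.rev_rev] at hrev
        exact hrev hi
      · exact P.ne_rev (Finset.mem_of_mem_erase hi) (Finset.mem_of_mem_erase h) rfl
  refine ⟨IndexSet.ofRev _ hcard hindex, Or.inl ⟨p, hp, p', hlt, hp', hpr, hrev, rfl⟩, ?_, ?_⟩
  · rw [IndexSet.le_iff_card_below]
    intro k
    have h1 := sum_replace hp hp' fun i => if (i : ℕ) < k then 1 else 0
    rw [← card_below_eq_sum, ← card_below_eq_sum] at h1
    have h2 := hle k
    have h3 := hk k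
    change (below (insert p' (P.carrier.erase p)) k).card ≤ _
    split_ifs at h1 <;> omega
  · have := sum_replace hp hp' fun i => (i : ℕ)
    rw [Fin.lt_def] at hlt
    change ∑ i ∈ insert p' (P.carrier.erase p), (i : ℕ) < _
    omega

/-- The counts rise by one on each of two windows; by `hdisj` these do not overlap, so one unit of
slack suffices. -/
lemma exists_isStep_double (P Q : IndexSet N m)
    (hle : ∀ k, (below P.carrier k).card ≤ (below Q.carrier k).card)
    {p r : Fin N} (hp : p ∈ P.carrier) (hr : r ∈ P.carrier) (hpr : r ≠ p) (hlt : r.rev < p)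
    (hk : ∀ k : ℕ, (r.rev : ℕ) < k → k ≤ p → (below P.carrier k).card < (below Q.carrier k).card)
    (hk' : ∀ k : ℕ, (p.rev : ℕ) < k → k ≤ r → (below P.carrier k).card < (below Q.carrier k).card)
    (hdisj : ∀ k : ℕ, (r.rev : ℕ) < k → k ≤ p → (p.rev : ℕ) < k → ¬ k ≤ r) :
    ∃ P', IsStep P P' ∧ Q ≤ P' ∧ ∑ i ∈ P'.carrier, (i : ℕ) < ∑ i ∈ P.carrier, (i : ℕ) := by
  have hp' : p.rev ∉ P.carrier := fun h => P.ne_rev hp h rfl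
  have hr' : r.rev ∉ P.carrier := fun h => P.ne_rev hr h rfl
  have hpr' : r.rev ≠ p.rev := fun h => hpr (Fin.rev_injective h)
  have hsum := sum_replace_two hp hr hpr hp' hr' hpr'
  set A := insert r.rev (insert p.rev ((P.carrier.erase p).erase r)) with hA
  have hcard : A.card = m := by
    have := hsum fun _ => 1
    simp only [Finset.sum_const, smul_eq_mul, mul_one, P.card_eq] at this
    omega
  have hmem : ∀ i, i ∈ A ↔ i = r.rev ∨ i = p.rev ∨ i ≠ r ∧ i ≠ p ∧ i ∈ P.carrier := by
    intro i
    simp [hA]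
  have hpp : p.rev ≠ p := fun h => hp' (h.symm ▸ hp)
  have hrr : r.rev ≠ r := fun h => hr' (h.symm ▸ hr)
  have hrp : r ≠ p.rev := fun h => hp' (h ▸ hr)
  have hprv : p ≠ r.rev := fun h => hr' (h ▸ hp)
  have hindex : ∀ i ∈ A, i.rev ∉ A := by
    intro i hi hir
    rw [hmem] at hi hir
    rcases hi with rfl | rfl | ⟨h1, h2, h3⟩
    · rw [Fin.rev_rev] at hir
      tauto
    · rw [Fin.rev_rev] at hir
      tauto
    · rw [Fin.rev_inj, Fin.rev_inj] at hir
      exact (P.ne_rev h3 (by tauto)) rfl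
  refine ⟨IndexSet.ofRev A hcard hindex, Or.inr ⟨p, hp, r, hr, hpr, hlt, hA⟩, ?_, ?_⟩
  · rw [IndexSet.le_iff_card_below]
    intro k
    have h1 := hsum fun i => if (i : ℕ) < k then 1 else 0
    rw [← card_below_eq_sum, ← card_below_eq_sum] at h1
    have h2 := hle k
    have h3 := hk k
    have h4 := hk' k
    have h5 := hdisj k
    change (below A k).card ≤ _
    split_ifs at h1 <;> omega
  · have := hsum fun i => (i : ℕ)
    rw [Fin.lt_def] at hlt
    change ∑ i ∈ A, (i : ℕ) < _
    rw [Fin.val_rev] at this hlt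
    rw [Fin.val_rev] at this
    omega

/-- Below any `P` strictly larger than `Q` there is an elementary step staying above `Q`. -/
lemma exists_isStep (hN : Odd N) (P Q : IndexSet N m) (hQP : Q ≤ P) (hne : P.carrier ≠ Q.carrier) :
    ∃ P', IsStep P P' ∧ Q ≤ P' ∧ ∑ i ∈ P'.carrier, (i : ℕ) < ∑ i ∈ P.carrier, (i : ℕ) := by
  have hle := (IndexSet.le_iff_card_below Q P).1 hQP
  have hD : (symmDiff P.carrier Q.carrier).Nonempty := Finset.symmDiff_nonempty.2 hne
  obtain ⟨q, hqD, hqmin⟩ : ∃ q ∈ symmDiff P.carrier Q.carrier,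
      ∀ i ∈ symmDiff P.carrier Q.carrier, q ≤ i := ⟨_, Finset.min'_mem _ hD, Finset.min'_le _⟩
  have hbelow : below P.carrier q = below Q.carrier q := by
    ext i
    rw [mem_below, mem_below]
    refine and_congr_left fun hi => ?_
    by_contra hcon
    have := hqmin i (by rw [Finset.mem_symmDiff]; tauto)
    rw [Fin.le_def] at this
    omega
  have hPq := card_below_succ P.carrier q
  have hQq := card_below_succ Q.carrier q
  have hleq := hle (q + 1)
  rw [hbelow] at hPq
  -- At the first difference the count of `Q` cannot fall behind that of `P`.
  have hq : q ∈ Q.carrier ∧ q ∉ P.carrier := by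
    rcases Finset.mem_symmDiff.1 hqD with ⟨h1, h2⟩ | h
    · rw [if_pos h1] at hPq
      rw [if_neg h2] at hQq
      omega
    · exact h
  obtain ⟨hqQ, hqP⟩ := hq
  rw [if_neg hqP] at hPq
  rw [if_pos hqQ] at hQq
  have hE : (P.carrier.filter fun i => q < i).Nonempty := by
    by_contra hcon
    rw [Finset.not_nonempty_iff_eq_empty, Finset.filter_eq_empty_iff] at hcon
    have h1 : below P.carrier (q + 1) = P.carrier := by
      refine Finset.filter_true_of_mem fun i hi => ?_
      have := hcon hi
      rw [Fin.lt_def] at this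
      omega
    have h2 : (below Q.carrier (q + 1)).card ≤ Q.carrier.card :=
      Finset.card_le_card (Finset.filter_subset _ _)
    rw [h1, P.card_eq] at hPq
    rw [Q.card_eq] at h2
    omega
  obtain ⟨p, hpE, hpmin⟩ : ∃ p ∈ P.carrier.filter fun i => q < i,
      ∀ i ∈ P.carrier.filter fun i => q < i, p ≤ i := ⟨_, Finset.min'_mem _ hE, Finset.min'_le _⟩
  obtain ⟨hpP, hqp⟩ := Finset.mem_filter.1 hpE
  have hgap : ∀ i : Fin N, q ≤ i → i < p → i ∉ P.carrier := by
    intro i h1 h2 hi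
    rcases h1.eq_or_lt with rfl | h1
    · exact hqP hi
    · exact (hpmin i (Finset.mem_filter.2 ⟨hi, h1⟩)).not_gt h2
  have hstrict : ∀ k : ℕ, (q : ℕ) < k → k ≤ p →
      (below P.carrier k).card < (below Q.carrier k).card := by
    intro k h1 h2
    have h3 : below P.carrier k = below P.carrier q := by
      ext i
      rw [mem_below, mem_below]
      refine and_congr_right fun hi => ⟨fun h => ?_, fun h => by omega⟩
      by_contra h4
      exact hgap i (Fin.le_def.2 (by omega)) (Fin.lt_def.2 (by omega)) hi
    have h4 := card_below_mono Q.carrier (show (q : ℕ) + 1 ≤ k from h1)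
    rw [h3, hbelow]
    omega
  -- Either some position in `[q, p)` can replace `p`, or every non-middle position there is blocked
  -- by its mirror image in `P`.
  by_cases hA : ∃ p', q ≤ p' ∧ p' < p ∧ p'.rev ≠ p' ∧ p'.rev ∉ P.carrier.erase p
  · obtain ⟨p', h1, h2, h3, h4⟩ := hA
    rw [Fin.le_def] at h1
    exact exists_isStep_single P Q hle hpP h2 (hgap p' h1 h2) h3 h4 fun k hk hk' =>
      hstrict k (by omega) hk'
  · have hfull : ∀ i : Fin N, q ≤ i → i < p → i.rev ≠ i → i.rev ∈ P.carrier ∧ i.rev ≠ p := by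
      intro i h1 h2 h3
      by_contra h4
      refine hA ⟨i, h1, h2, h3, fun h5 => h4 ?_⟩
      exact ⟨Finset.mem_of_mem_erase h5, Finset.ne_of_mem_erase h5⟩
    have hqr : q.rev ≠ q := fun h => Q.ne_rev hqQ hqQ h.symm
    obtain ⟨n, hn⟩ := hN
    have hq2 := q.2
    have hp2 := p.2
    rw [Fin.lt_def] at hqp
    have hfull' : ∀ i : Fin N, q ≤ i → i < p → i.rev ∈ P.carrier := by
      intro i h1 h2
      refine (hfull i h1 h2 fun h3 => ?_).1
      have h1' := Fin.le_def.1 h1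
      have h2' := Fin.lt_def.1 h2
      have h3' := congrArg Fin.val h3
      have hqr' : (q.rev : ℕ) ≠ q := fun h => hqr (Fin.ext h)
      rw [Fin.val_rev] at h3' hqr'
      -- The middle position is `n`. If it lay in `[q, p)`, so would `n - 1`, whose mirror image `n
      -- + 1` would be in `P` and different from `p`, contradicting the gap below `p`.
      let l : Fin N := ⟨n - 1, by omega⟩
      have hl : (l.rev : ℕ) = n + 1 := by
        rw [Fin.val_rev]
        change N - (n - 1 + 1) = n + 1
        omega
      obtain ⟨h4, h5⟩ := hfull l (Fin.le_def.2 (by change (q : ℕ) ≤ n - 1; omega))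
        (Fin.lt_def.2 (by change n - 1 < (p : ℕ); omega)) fun h => by
          have := congrArg Fin.val h
          rw [hl] at this
          change n + 1 = n - 1 at this
          omega
      have h5' : (l.rev : ℕ) ≠ p := fun h => h5 (Fin.ext h)
      exact hgap _ (Fin.le_def.2 (by omega)) (Fin.lt_def.2 (by omega)) h4
    obtain ⟨hrP, hrp⟩ := hfull q le_rfl hqp hqr
    have hrQ : q.rev ∉ Q.carrier := fun h => Q.ne_rev hqQ h rfl
    have hmem : ∀ k : Fin N, (p.rev : ℕ) < k → (k : ℕ) ≤ q.rev → k ∈ P.carrier := by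
      intro k h1 h2
      rw [Fin.val_rev] at h1 h2
      have := hfull' k.rev (Fin.le_def.2 (by rw [Fin.val_rev]; omega))
        (Fin.lt_def.2 (by rw [Fin.val_rev]; omega))
      rwa [Fin.rev_rev] at this
    -- Downward induction from `q.rev`, which is in `P` but not in `Q`. Every position passed
    -- belongs to `P`, so the strict inequality persists.
    have hstrict' : ∀ d k : ℕ, k + d = q.rev → (p.rev : ℕ) < k →
        (below P.carrier k).card < (below Q.carrier k).card := by
      intro d
      induction d with
      | zero =>
        intro k hk _
        have h1 := card_below_succ P.carrier q.rev
        have h2 := card_below_succ Q.carrier q.rev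
        rw [if_pos hrP] at h1
        rw [if_neg hrQ] at h2
        have h3 := hle (q.rev + 1)
        rw [add_zero] at hk
        rw [hk]
        omega
      | succ d ih =>
        intro k hk hpk
        have h0 := ih (k + 1) (by omega) (by omega)
        have hkN : k < N := by
          have := q.rev.2
          omega
        let i : Fin N := ⟨k, hkN⟩
        have h1 : (below P.carrier (k + 1)).card = (below P.carrier k).card + _ :=
          card_below_succ P.carrier i
        have h2 : (below Q.carrier (k + 1)).card = (below Q.carrier k).card + _ :=
          card_below_succ Q.carrier i
        rw [if_pos (hmem i hpk (by change k ≤ _; omega))] at h1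
        have h3 : (if i ∈ Q.carrier then 1 else 0) ≤ 1 := by split_ifs <;> omega
        omega
    refine exists_isStep_double P Q hle hpP hrP hrp (by rwa [Fin.rev_rev]) ?_ ?_ ?_
    · rw [Fin.rev_rev]
      exact hstrict
    · intro k h1 h2
      exact hstrict' (q.rev - k) k (by omega) h1
    · rw [Fin.rev_rev]
      intro k h1 h2 h3 h4
      -- Otherwise `k = p` and `k - 1 = p.rev`, forcing `N = 2p`, against oddness. In both cases a
      -- position of `P` falls in the gap `[q, p)`.
      have hmid : (p.rev : ℕ) < k - 1 ∨ k < p := by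
        rw [Fin.val_rev] at h3 ⊢
        omega
      rcases hmid with h | h
      · let i : Fin N := ⟨k - 1, by omega⟩
        exact hgap i (Fin.le_def.2 (by change (q : ℕ) ≤ k - 1; omega))
          (Fin.lt_def.2 (by change k - 1 < (p : ℕ); omega))
          (hmem i h (by change k - 1 ≤ (q.rev : ℕ); omega))
      · let i : Fin N := ⟨k, by omega⟩
        exact hgap i (Fin.le_def.2 (by change (q : ℕ) ≤ k; omega)) (Fin.lt_def.2 h) (hmem i h3 h4)

end

/-! ### Curves realizing the elementary steps. -/

section

variable {V : Type*} [AddCommGroup V] [Module ℂ V] {N m : ℕ}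
variable {B : LinearMap.BilinForm ℂ V} {F : Fin (N + 1) → Submodule ℂ V}
  {e : Basis (Fin N) ℂ V}

lemma IsAdaptedBasis.form_basis_eq_zero (he : IsAdaptedBasis B F e) {i j : Fin N} (h : j ≠ i.rev) :
    B (e i) (e j) = 0 := by
  rw [he.form_basis, if_neg h]

lemma IsAdaptedBasis.form_indexSet (he : IsAdaptedBasis B F e) (P : IndexSet N m) {i j : Fin N}
    (hi : i ∈ P.carrier) (hj : j ∈ P.carrier) : B (e i) (e j) = 0 :=
  he.form_basis_eq_zero (P.ne_rev hi hj)

/-- Degeneration moving a single vector `e p` along the curve `x`. -/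
lemma schubertCell_subset_of_replace (hN : Odd N) (hB : B.IsSymm) (hnd : B.Nondegenerate)
    (he : IsAdaptedBasis B F e) (P P' : IndexSet N m) {p p' : Fin N}
    (hP' : P'.carrier = insert p' (P.carrier.erase p)) (hp : p ∈ P.carrier) (x : ℂ → V)
    (hx : ∀ s, B (x s) (x s) = 0) (hxP : ∀ s, ∀ j ∈ P.carrier, j ≠ p → B (x s) (e j) = 0)
    (hcont : ∀ φ : Dual ℂ V, Continuous fun s => φ (x s))
    (h1 : ∀ s, x s ∈ initial e (p + 1)) (h2 : ∀ s, s ≠ 0 → e.repr (x s) p ≠ 0)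
    (c : ℂ) (hc : c ≠ 0) (h0 : x 0 = c • e p') :
    schubertCell B F e P' ⊆ schubertVariety B F e P := by
  refine schubertCell_subset_of_curve hN hB hnd he P P'
    (fun s i => if i = p then x s else e i) ?_ ?_ ?_ ?_ (fun i => if i = p then p' else i) ?_
    (fun i => if i = p then c else 1) ?_ ?_
  · intro s i hi j hj
    split_ifs with h h' h'
    · exact hx s
    · exact hxP s j hj h'
    · rw [hB.eq]
      exact hxP s i hi h
    · exact he.form_indexSet P hi hj
  · intro φ j
    split_ifs
    · exact hcont φ
    · exact continuous_const
  · intro s _ j _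
    split_ifs with h
    · rw [h]
      exact h1 s
    · exact basis_mem_initial e (Nat.lt_succ_self _)
  · intro s hs j _
    split_ifs with h
    · rw [h]
      exact h2 s hs
    · simp
  · rw [hP']
    ext i
    simp only [Finset.mem_insert, Finset.mem_erase, Finset.mem_image]
    constructor
    · rintro (rfl | ⟨h, hi⟩)
      · exact ⟨p, hp, if_pos rfl⟩
      · exact ⟨i, hi, if_neg h⟩
    · rintro ⟨j, hj, hji⟩
      split_ifs at hji with h
      · exact Or.inl hji.symm
      · subst hji
        exact Or.inr ⟨h, hj⟩
  · intro j
    split_ifs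
    · exact hc
    · exact one_ne_zero
  · intro j _
    split_ifs
    · exact h0
    · rw [one_smul]

lemma schubertCell_subset_of_single (hN : Odd N) (hB : B.IsSymm) (hnd : B.Nondegenerate)
    (he : IsAdaptedBasis B F e) (P P' : IndexSet N m) {p p' : Fin N} (hp : p ∈ P.carrier)
    (hlt : p' < p) (hpr : p'.rev ≠ p') (hrev : p'.rev ∉ P.carrier.erase p)
    (hP' : P'.carrier = insert p' (P.carrier.erase p)) :
    schubertCell B F e P' ⊆ schubertVariety B F e P := by
  have hlt' := Fin.lt_def.1 hlt
  have hpp : B (e p) (e p) = 0 := he.form_indexSet P hp hp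
  have hp'p' : B (e p') (e p') = 0 := he.form_basis_eq_zero hpr.symm
  have hp'j : ∀ j ∈ P.carrier, j ≠ p → B (e p') (e j) = 0 := fun j hj hjp =>
    he.form_basis_eq_zero fun h => hrev (h ▸ Finset.mem_erase.2 ⟨hjp, hj⟩)
  by_cases hcase : p'.rev = p
  · obtain ⟨n, hn⟩ := hN
    let μ : Fin N := ⟨n, by omega⟩
    have hμ : μ.rev = μ := by
      rw [Fin.ext_iff, Fin.val_rev]
      change N - (n + 1) = n
      omega
    have hval := congrArg Fin.val hcase
    rw [Fin.val_rev] at hval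
    have hμp : (μ : ℕ) < p := by
      change n < (p : ℕ)
      omega
    have hμp' : (p' : ℕ) < μ := by
      change (p' : ℕ) < n
      omega
    have hprev : p.rev = p' := by rw [← hcase, Fin.rev_rev]
    have e1 : B (e p) (e p') = 1 := by rw [he.form_basis, if_pos hprev.symm]
    have e2 : B (e μ) (e μ) = 1 := by rw [he.form_basis, if_pos hμ.symm]
    have e3 : B (e p) (e μ) = 0 := he.form_basis_eq_zero (by
      rw [hprev]; exact fun h => hμp'.ne (congrArg Fin.val h.symm))
    have e4 : B (e p') (e μ) = 0 := he.form_basis_eq_zero (by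
      rw [hcase]; exact fun h => hμp.ne (congrArg Fin.val h))
    have e5 : ∀ j ∈ P.carrier, B (e μ) (e j) = 0 := fun j hj => he.form_basis_eq_zero (by
      rw [hμ]
      rintro rfl
      exact P.ne_rev hj hj hμ.symm)
    -- Here `e p` and `e p'` pair to 1, so the line joining them is not isotropic. A conic through
    -- the middle vector is: its norm is `s² - 2 · s² · (1/2) = 0`.
    refine schubertCell_subset_of_replace ⟨n, hn⟩ hB hnd he P P' hP' hp
      (fun s => s ^ 2 • e p + s • e μ - (1 / 2 : ℂ) • e p') ?_ ?_ ?_ ?_ ?_ (-(1 / 2)) (by norm_num) ?_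
    · intro s
      simp only [map_add, map_sub, map_smul, LinearMap.add_apply, LinearMap.sub_apply,
        LinearMap.smul_apply, smul_eq_mul, hB.eq (e p') (e p), hB.eq (e μ) (e p),
        hB.eq (e μ) (e p'), e1, e2, e3, e4, hpp, hp'p']
      ring
    · intro s j hj hjp
      simp [he.form_indexSet P hp hj, e5 j hj, hp'j j hj hjp]
    · intro φ
      simp only [map_add, map_sub, map_smul, smul_eq_mul]
      fun_prop
    · intro s
      exact sub_mem (add_mem (Submodule.smul_mem _ _ (basis_mem_initial e (Nat.lt_succ_self _)))
        (Submodule.smul_mem _ _ (basis_mem_initial e (by omega))))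
        (Submodule.smul_mem _ _ (basis_mem_initial e (by omega)))
    · intro s hs
      have n1 : μ ≠ p := fun h => hμp.ne (congrArg Fin.val h)
      simp [Finsupp.single_eq_of_ne n1.symm, Finsupp.single_eq_of_ne hlt.ne.symm, hs]
    · simp
  · have e1 : B (e p) (e p') = 0 := he.form_basis_eq_zero fun h => hcase (by rw [h, Fin.rev_rev])
    refine schubertCell_subset_of_replace hN hB hnd he P P' hP' hp
      (fun s => s • e p + e p') ?_ ?_ ?_ ?_ ?_ 1 one_ne_zero ?_
    · intro s
      simp [hB.eq (e p') (e p), e1, hpp, hp'p']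
    · intro s j hj hjp
      simp [he.form_indexSet P hp hj, hp'j j hj hjp]
    · intro φ
      simp only [map_add, map_smul, smul_eq_mul]
      fun_prop
    · intro s
      exact add_mem (Submodule.smul_mem _ _ (basis_mem_initial e (Nat.lt_succ_self _)))
        (basis_mem_initial e (by omega))
    · intro s hs
      simp [Finsupp.single_eq_of_ne hlt.ne.symm, hs]
    · simp

lemma schubertCell_subset_of_double (hN : Odd N) (hB : B.IsSymm) (hnd : B.Nondegenerate)
    (he : IsAdaptedBasis B F e) (P P' : IndexSet N m) {p r : Fin N} (hp : p ∈ P.carrier)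
    (hr : r ∈ P.carrier) (hrp : r ≠ p) (hlt : r.rev < p)
    (hP' : P'.carrier = insert r.rev (insert p.rev ((P.carrier.erase p).erase r))) :
    schubertCell B F e P' ⊆ schubertVariety B F e P := by
  have hlt' := Fin.lt_def.1 hlt
  have hlt2 : p.rev < r := Fin.rev_lt_iff.2 hlt
  have hlt2' := Fin.lt_def.1 hlt2
  have hp' : p.rev ≠ p := fun h => P.ne_rev hp hp h.symm
  have hr' : r.rev ≠ r := fun h => P.ne_rev hr hr h.symm
  have a1 : B (e p) (e p.rev) = 1 := by rw [he.form_basis, if_pos rfl]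
  have a2 : B (e r) (e r.rev) = 1 := by rw [he.form_basis, if_pos rfl]
  have a3 : B (e p) (e r.rev) = 0 := he.form_basis_eq_zero fun h => hrp (Fin.rev_injective h)
  have a4 : B (e r) (e p.rev) = 0 := he.form_basis_eq_zero fun h => hrp (Fin.rev_injective h).symm
  have a5 : B (e p.rev) (e p.rev) = 0 := he.form_basis_eq_zero (by rwa [Fin.rev_rev])
  have a6 : B (e r.rev) (e r.rev) = 0 := he.form_basis_eq_zero (by rwa [Fin.rev_rev])
  have a7 : B (e p.rev) (e r.rev) = 0 := he.form_basis_eq_zero (by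
    rw [Fin.rev_rev]
    rintro rfl
    exact P.ne_rev hr hp rfl)
  have b1 : ∀ j, j ≠ p → B (e p.rev) (e j) = 0 := fun j h => he.form_basis_eq_zero (by
    rwa [Fin.rev_rev])
  have b2 : ∀ j, j ≠ r → B (e r.rev) (e j) = 0 := fun j h => he.form_basis_eq_zero (by
    rwa [Fin.rev_rev])
  have c1 := he.form_indexSet P hp hp
  have c2 := he.form_indexSet P hr hr
  have c3 := he.form_indexSet P hp hr
  let x : ℂ → V := fun s => s • e p + e r.rev
  -- The minus sign cancels the pairings of `e p` with `e p.rev` and of `e r` with `e r.rev`,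
  -- keeping `x` and `y` orthogonal.
  let y : ℂ → V := fun s => s • e r - e p.rev
  have hxx : ∀ s, B (x s) (x s) = 0 := fun s => by
    simp [x, hB.eq (e r.rev) (e p), c1, a3, a6]
  have hyy : ∀ s, B (y s) (y s) = 0 := fun s => by
    simp [y, hB.eq (e p.rev) (e r), c2, a4, a5]
  have hxy : ∀ s, B (x s) (y s) = 0 := fun s => by
    simp [x, y, hB.eq (e r.rev) (e r), hB.eq (e r.rev) (e p.rev), c3, a1, a2, a7]
  have hxj : ∀ s, ∀ j ∈ P.carrier, j ≠ r → B (x s) (e j) = 0 := fun s j hj h => by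
    simp [x, he.form_indexSet P hp hj, b2 j h]
  have hyj : ∀ s, ∀ j ∈ P.carrier, j ≠ p → B (y s) (e j) = 0 := fun s j hj h => by
    simp [y, he.form_indexSet P hr hj, b1 j h]
  refine schubertCell_subset_of_curve hN hB hnd he P P'
    (fun s i => if i = p then x s else if i = r then y s else e i) ?_ ?_ ?_ ?_
    (fun i => if i = p then r.rev else if i = r then p.rev else i) ?_
    (fun i => if i = r then -1 else 1) ?_ ?_
  · intro s i hi j hj
    split_ifs
    · exact hxx s
    · exact hxy s
    · exact hxj s j hj ‹¬j = r›
    · rw [hB.eq]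
      exact hxy s
    · exact hyy s
    · exact hyj s j hj ‹¬j = p›
    · rw [hB.eq]
      exact hxj s i hi ‹¬i = r›
    · rw [hB.eq]
      exact hyj s i hi ‹¬i = p›
    · exact he.form_indexSet P hi hj
  · intro φ j
    split_ifs
    · simp only [x, map_add, map_smul, smul_eq_mul]
      fun_prop
    · simp only [y, map_sub, map_smul, smul_eq_mul]
      fun_prop
    · exact continuous_const
  · intro s _ j _
    split_ifs with h h'
    · rw [h]
      exact add_mem (Submodule.smul_mem _ _ (basis_mem_initial e (Nat.lt_succ_self _)))
        (basis_mem_initial e (by omega))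
    · rw [h']
      exact sub_mem (Submodule.smul_mem _ _ (basis_mem_initial e (Nat.lt_succ_self _)))
        (basis_mem_initial e (by omega))
    · exact basis_mem_initial e (Nat.lt_succ_self _)
  · intro s hs j _
    split_ifs with h h'
    · simp [h, x, Finsupp.single_eq_of_ne hlt.ne.symm, hs]
    · simp [h', y, Finsupp.single_eq_of_ne hlt2.ne.symm, hs]
    · simp
  · rw [hP']
    ext i
    simp only [Finset.mem_insert, Finset.mem_erase, Finset.mem_image]
    constructor
    · rintro (rfl | rfl | ⟨h, h', hi⟩)
      · exact ⟨p, hp, if_pos rfl⟩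
      · exact ⟨r, hr, by rw [if_neg hrp, if_pos rfl]⟩
      · exact ⟨i, hi, by rw [if_neg h', if_neg h]⟩
    · rintro ⟨j, hj, hji⟩
      split_ifs at hji with h h'
      · exact Or.inl hji.symm
      · exact Or.inr (Or.inl hji.symm)
      · subst hji
        exact Or.inr (Or.inr ⟨h', h, hj⟩)
  · intro j
    split_ifs <;> norm_num
  · intro j _
    split_ifs with h h' h'
    · exact absurd (h'.symm.trans h) hrp
    · simp [x]
    · simp [y]
    · rw [one_smul]

lemma IsStep.schubertCell_subset (hN : Odd N) (hB : B.IsSymm) (hnd : B.Nondegenerate)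
    (he : IsAdaptedBasis B F e) {P P' : IndexSet N m} (h : IsStep P P') :
    schubertCell B F e P' ⊆ schubertVariety B F e P := by
  rcases h with ⟨p, hp, p', hlt, -, hpr, hrev, hP'⟩ | ⟨p, hp, r, hr, hrp, hlt, hP'⟩
  · exact schubertCell_subset_of_single hN hB hnd he P P' hp hlt hpr hrev hP'
  · exact schubertCell_subset_of_double hN hB hnd he P P' hp hr hrp hlt hP'

/-- Schubert cells are contained in the larger Schubert varieties. -/
lemma schubertCell_subset_of_le (hN : Odd N) (hB : B.IsSymm) (hnd : B.Nondegenerate)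
    (he : IsAdaptedBasis B F e) (Q : IndexSet N m) (d : ℕ) :
    ∀ P : IndexSet N m, ∑ i ∈ P.carrier, (i : ℕ) = d → Q ≤ P →
      schubertCell B F e Q ⊆ schubertVariety B F e P := by
  induction d using Nat.strong_induction_on with
  | _ d ih =>
    intro P hd hQP
    by_cases hne : P.carrier = Q.carrier
    · have : schubertCell B F e Q = schubertCell B F e P := by
        rw [schubertCell, schubertCell, hne]
      rw [this]
      exact subset_closure
    · obtain ⟨P', hstep, hQP', hlt⟩ := exists_isStep hN P Q hQP hne
      exact (ih _ (hd ▸ hlt) P' rfl hQP').trans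
        (closure_minimal (hstep.schubertCell_subset hN hB hnd he) isClosed_closure)

/-! ### Cell decomposition of the rank loci and the final comparison. -/

lemma mem_schubertCell_leadIndex (hN : Odd N) (hB : B.IsSymm) (hnd : B.Nondegenerate)
    (he : IsAdaptedBasis B F e) (S : OG B m) : S ∈ schubertCell B F e (leadIndex he S) :=
  mem_schubertCell hN hB hnd he _ S subset_rfl

lemma mem_rankLocus_iff (he : IsAdaptedBasis B F e) (P : IndexSet N m) (S : OG B m) :
    S ∈ rankLocus B F P ↔ leadIndex he S ≤ P := by
  refine forall_congr' fun j => ?_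
  rw [he.flag_eq, finrank_inf_initial, Fin.val_succ, Nat.succ_le_iff, Fin.le_def,
    ← Nat.lt_succ_iff]
  exact (leadIndex he S).lt_card_below_iff j _

/-- A point `S` of the closure has a neighbourhood where no intersection dimension exceeds its value
at `S`; a point of the locus in it transfers the lower bounds to `S`. -/
lemma isClosed_rankLocus (hN : Odd N) (hB : B.IsSymm) (hnd : B.Nondegenerate)
    (he : IsAdaptedBasis B F e) (P : IndexSet N m) : IsClosed (rankLocus B F P) := by
  refine isClosed_of_closure_subset fun S hS => ?_
  obtain ⟨U, hU, hSU, hle⟩ :=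
    exists_isOpen_finrank_le he _ (mem_schubertCell_leadIndex hN hB hnd he S)
  obtain ⟨T, hTU, hT⟩ := mem_closure_iff.1 hS U hU hSU
  intro j
  refine (hT j).trans ((hle T hTU _).trans ?_)
  rw [he.flag_eq, finrank_inf_initial]
  exact le_rfl

/-- Points of the cell of `Q` have leading positions `Q`. -/
lemma carrier_eq_leads (he : IsAdaptedBasis B F e) (Q : IndexSet N m) {S : OG B m}
    (hS : S ∈ schubertCell B F e Q) : Q.carrier = leads e S.1 := by
  obtain ⟨g, hg, hS'⟩ := hS
  have hgi := isFlagIsometry_of_mem_borel hg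
  refine Finset.eq_of_subset_of_card_le (fun q hq => ?_) ?_
  · have h1 : g (e q) ∈ initial e (q + 1) := by
      have := (hgi.mem_iff q.succ (x := e q)).2
      rw [he.flag_eq] at this
      exact this (basis_mem_initial e (Nat.lt_succ_self _))
    refine mem_leads.2 ⟨g (e q), ?_, h1, fun h0 => ?_⟩
    · rw [hS']
      exact Submodule.mem_map_of_mem (Submodule.subset_span ⟨q, hq, rfl⟩)
    · have := (hgi.mem_iff q.castSucc (x := e q)).1
      rw [he.flag_eq] at this
      have h2 := this ((initial_succ_inf_ker e q).2 ⟨h1, h0⟩) q le_rfl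
      simp at h2
  · rw [← finrank_eq_card_leads, S.2.1, Q.card_eq]

lemma schubertCell_nonempty (he : IsAdaptedBasis B F e) (Q : IndexSet N m) :
    (schubertCell B F e Q).Nonempty := by
  refine ⟨spanPoint (fun j => e (Q.elem j)) (e.linearIndependent.comp _ Q.elem.injective)
    fun i j => he.form_indexSet Q (Q.elem_mem i) (Q.elem_mem j), 1,
    ⟨one_mem _, fun i => Submodule.map_id _⟩, ?_⟩
  change Submodule.span ℂ (Set.range (e ∘ Q.elem)) = Submodule.map LinearMap.id _
  rw [Submodule.map_id, Set.range_comp, Q.range_elem]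

/-- Membership depends only on leading positions, which are constant on a cell, so a single point
decides. -/
lemma schubertCell_subset_rankLocus_iff (he : IsAdaptedBasis B F e) (P Q : IndexSet N m) :
    schubertCell B F e Q ⊆ rankLocus B F P ↔ Q ≤ P := by
  have key : ∀ S ∈ schubertCell B F e Q, S ∈ rankLocus B F P ↔ Q ≤ P := fun S hS => by
    rw [mem_rankLocus_iff he, IndexSet.le_iff_card_below, IndexSet.le_iff_card_below,
      carrier_eq_leads he Q hS]
    rfl
  obtain ⟨S, hS⟩ := schubertCell_nonempty he Q
  exact ⟨fun h => (key S hS).1 (h hS), fun h T hT => (key T hT).2 h⟩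

theorem schubertVariety_eq_rankLocus (hN : Odd N) (hB : B.IsSymm) (hnd : B.Nondegenerate)
    (he : IsAdaptedBasis B F e) (P : IndexSet N m) :
    schubertVariety B F e P = rankLocus B F P := by
  apply subset_antisymm
  · exact closure_minimal ((schubertCell_subset_rankLocus_iff he P P).2 fun _ => le_rfl)
      (isClosed_rankLocus hN hB hnd he P)
  · intro S hS
    exact schubertCell_subset_of_le hN hB hnd he _ _ P rfl ((mem_rankLocus_iff he P S).1 hS)
      (mem_schubertCell_leadIndex hN hB hnd he S)

theorem schubertVariety_subset_iff (hN : Odd N) (hB : B.IsSymm) (hnd : B.Nondegenerate)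
    (he : IsAdaptedBasis B F e) (P Q : IndexSet N m) :
    schubertVariety B F e Q ⊆ schubertVariety B F e P ↔ Q ≤ P := by
  rw [schubertVariety_eq_rankLocus hN hB hnd he P, ← schubertCell_subset_rankLocus_iff he P Q]
  exact (isClosed_rankLocus hN hB hnd he P).closure_subset_iff

end

end OrthogonalGrassmannian

theorem mainTheorem12 {V : Type*} [AddCommGroup V] [Module ℂ V] (n m : ℕ)
    (hm : 2 * m < 2 * n + 1)
    (B : LinearMap.BilinForm ℂ V) (hsymm : B.IsSymm) (hnd : B.Nondegenerate)
    (F : Fin (2 * n + 1 + 1) → Submodule ℂ V) (hF : OrthogonalGrassmannian.IsIsotropicFlag B F)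
    (e : Module.Basis (Fin (2 * n + 1)) ℂ V) (he : OrthogonalGrassmannian.IsAdaptedBasis B F e) :
    (∀ P : OrthogonalGrassmannian.IndexSet (2 * n + 1) m,
      OrthogonalGrassmannian.schubertVariety B F e P = OrthogonalGrassmannian.rankLocus B F P) ∧
    (∀ P Q : OrthogonalGrassmannian.IndexSet (2 * n + 1) m,
      OrthogonalGrassmannian.schubertVariety B F e Q ⊆
        OrthogonalGrassmannian.schubertVariety B F e P ↔ Q ≤ P) :=
  ⟨fun P => OrthogonalGrassmannian.schubertVariety_eq_rankLocus ⟨n, rfl⟩ hsymm hnd he P,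
    fun P Q => OrthogonalGrassmannian.schubertVariety_subset_iff ⟨n, rfl⟩ hsymm hnd he P Q⟩
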